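/- Let $k$ be a field of characteristic zero, let $\Omega$ be a nonempty finite set, and let $\mathscr P=\mathscr T(M)/\langle R\rangle$ be a finitely generated binary quadratic symmetric operad over $k$: $M$ is an $\mathbb S$-module concentrated in arity $2$ with $M(2)$ finite-dimensional, $\mathscr T(M)$ is the free operad on $M$, and $R\subseteq\mathscr T(M)(3)$ is an $S_3$-submodule. Recall that $\mathscr T(M)(3)$ is the direct sum of three copies of $M(2)\otimes M(2)$, one for each of the tree shapes $((1,2),3)$, $((2,3),1)$, $((3,1),2)$; the two factors decorate the two vertices of the tree. The leveled matching operad of $\mathscr P$ is $$\mathscr P^{\rm LMT}_\Omega=\mathscr T\Big(\bigoplus_{\omega\in\Omega}M_\omega\Big)\Big/\langle R_{\rm LMT}\rangle ,$$ where $M_\omega=\{\mu^\omega\mid\mu\in M\}$ is a copy of $M$, and $R_{\rm LMT}$ consists of the elements obtained from some $r\in R$ and some $\omega,\tau\in\Omega$ (possibly equal) by replacing, simultaneously in all trees of $r$, the decoration $\mu$ of the root vertex by $\mu^{\omega}$ and the decoration $\nu$ of the other vertex by $\nu^{\tau}$. For $\mathscr P=\mathscr T(M)/\langle R\rangle$ and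 $\mathscr Q=\mathscr T(N)/\langle S\rangle$ as above, the Manin black product is $$\mathscr P\bullet\mathscr Q=\mathscr T(M\otimes N\otimes\mathrm{sgn})/\langle\Psi(R\otimes S)\rangle ,$$ where $\mathrm{sgn}$ is the sign representation of $S_2$ and $\Psi$ multiplies the decorations of equal tree shapes (among the three above) vertex by vertex, products of different shapes being zero; the Manin white product is $$\mathscr P\circ\mathscr Q=\mathscr T(M\otimes N)/\big\langle\Phi^{-1}\big(R\otimes\mathscr T(N)(3)+\mathscr T(M)(3)\otimes S\big)\big\rangle ,$$ where $\Phi:\mathscr T(M\otimes N)(3)\to\mathscr T(M)(3)\otimes\mathscr T(N)(3)$ sends a tree with vertices decorated by $\mu\otimes\nu$ and $\mu'\otimes\nu'$ to the tensor product of the same tree decorated by $\mu,\mu'$ with the same tree decorated by $\nu,\nu'$. Let $\mathrm{Lie}$ be presented by one antisymmetric generator and the Jacobi relation $((1,2),3)+((2,3),1)+((3,1),2)$, and $\mathrm{Com}$ by one symmetric generator and the relations $((1,2),3)=((2,3),1)=((3,1),2)$. Then there are isomorphisms of operads $$\mathrm{Lie}^{\rm LMT}_\Omega\bullet\mathscr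 P\;\cong\;\mathscr P^{\rm LMT}_\Omega\;\cong\;\mathrm{Com}^{\rm LMT}_\Omega\circ\mathscr P .$$ -/

import Mathlib

open scoped TensorProduct

universe u v w w'

namespace QuadOperad

section Arities

/-- The direct sum of the bijections `σ i`, acting block by block on `n 0 + n 1 + ⋯` letters. -/
def sumEquiv {l : ℕ} {n n' : Fin l → ℕ} (σ : ∀ i, Fin (n i) ≃ Fin (n' i)) :
    Fin (∑ i, n i) ≃ Fin (∑ i, n' i) :=
  finSigmaFinEquiv.symm.trans ((Equiv.sigmaCongrRight σ).trans finSigmaFinEquiv)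

/-- The block permutation: the block number `i` is moved to the place of block number `σ i`. -/
def blockEquiv {l l' : ℕ} (σ : Fin l ≃ Fin l') (n : Fin l' → ℕ) :
    Fin (∑ i, n (σ i)) ≃ Fin (∑ i, n i) :=
  finSigmaFinEquiv.symm.trans
    ((Equiv.sigmaCongrLeft (β := fun i => Fin (n i)) σ).trans finSigmaFinEquiv)

/-- A family indexed by pairs `(i, j)`, indexed by the position of `(i, j)` in lexicographic
order. -/
abbrev flatten {l : ℕ} {n : Fin l → ℕ} {X : Type*} (m : ∀ i, Fin (n i) → X) :
    Fin (∑ i, n i) → X :=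
  fun p => m (finSigmaFinEquiv.symm p).1 (finSigmaFinEquiv.symm p).2

/-- The canonical bijection between the letters of two-step and one-step concatenations. -/
def assocEquiv {l : ℕ} (n : Fin l → ℕ) (m : ∀ i, Fin (n i) → ℕ) :
    Fin (∑ p, flatten m p) ≃ Fin (∑ i, ∑ j, m i j) :=
  finSigmaFinEquiv.symm.trans <|
    (Equiv.sigmaCongrLeft (β := fun q : (Σ i, Fin (n i)) => Fin (m q.1 q.2))
      finSigmaFinEquiv.symm).trans <|
    (Equiv.sigmaAssoc (fun i j => Fin (m i j))).trans <|
    (Equiv.sigmaCongrRight (fun _ => finSigmaFinEquiv)).trans finSigmaFinEquiv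

/-- `n 0 = ∑ i : Fin 1, n i`. -/
def unitEquivLeft (n : Fin 1 → ℕ) : Fin (n 0) ≃ Fin (∑ i, n i) :=
  finCongr (by simp)

/-- `l = 1 + ⋯ + 1`. -/
def unitEquivRight (l : ℕ) : Fin l ≃ Fin (∑ _i : Fin l, 1) :=
  finCongr (by simp)

end Arities

/-- A symmetric operad over `k`.  The actions of the symmetric groups are given by the maps
`map e : obj n → obj m` for bijections `e : Fin n ≃ Fin m` (so `n = m`); `map e` renames the
input `j` to `e j`, and the usual right action of a permutation is `x · σ = map σ⁻¹ x`.
`comp n μ ν` is the composite `γ(μ; ν 0, ν 1, …)`. -/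
structure Operad (k : Type u) [Field k] where
  obj : ℕ → Type v
  [addCommGroup : ∀ n, AddCommGroup (obj n)]
  [module : ∀ n, Module k (obj n)]
  map : ∀ {n m : ℕ}, (Fin n ≃ Fin m) → obj n →ₗ[k] obj m
  one : obj 1
  comp : ∀ {l : ℕ} (n : Fin l → ℕ),
    obj l →ₗ[k] MultilinearMap k (fun i => obj (n i)) (obj (∑ i, n i))
  map_refl : ∀ {n : ℕ} (x : obj n), map (Equiv.refl (Fin n)) x = x
  map_trans : ∀ {n m p : ℕ} (e : Fin n ≃ Fin m) (f : Fin m ≃ Fin p) (x : obj n),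
    map (e.trans f) x = map f (map e x)
  comp_map_right : ∀ {l : ℕ} {n n' : Fin l → ℕ} (σ : ∀ i, Fin (n i) ≃ Fin (n' i))
    (μ : obj l) (ν : ∀ i, obj (n i)),
    comp n' μ (fun i => map (σ i) (ν i)) = map (sumEquiv σ) (comp n μ ν)
  comp_map_left : ∀ {l l' : ℕ} (σ : Fin l ≃ Fin l') (n : Fin l' → ℕ)
    (μ : obj l) (ν : ∀ i, obj (n i)),
    comp n (map σ μ) ν = map (blockEquiv σ n) (comp (fun i => n (σ i)) μ (fun i => ν (σ i)))
  comp_assoc : ∀ {l : ℕ} (n : Fin l → ℕ) (m : ∀ i, Fin (n i) → ℕ)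
    (μ : obj l) (ν : ∀ i, obj (n i)) (ξ : ∀ i j, obj (m i j)),
    map (assocEquiv n m) (comp (flatten m) (comp n μ ν)
      (fun p => ξ (finSigmaFinEquiv.symm p).1 (finSigmaFinEquiv.symm p).2)) =
    comp (fun i => ∑ j, m i j) μ (fun i => comp (m i) (ν i) (ξ i))
  one_comp : ∀ (n : Fin 1 → ℕ) (ν : ∀ i, obj (n i)),
    comp n one ν = map (unitEquivLeft n) (ν 0)
  comp_one : ∀ {l : ℕ} (μ : obj l),
    comp (fun _ => 1) μ (fun _ => one) = map (unitEquivRight l) μ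

attribute [instance] Operad.addCommGroup Operad.module

/-- An isomorphism of operads: linear isomorphisms in all arities that commute with the
symmetric groups, the unit and the compositions. -/
structure Operad.Iso {k : Type u} [Field k] (P : Operad.{u, v} k) (Q : Operad.{u, w} k) where
  equiv : ∀ n, P.obj n ≃ₗ[k] Q.obj n
  equiv_map : ∀ {n m : ℕ} (e : Fin n ≃ Fin m) (x : P.obj n),
    equiv m (P.map e x) = Q.map e (equiv n x)
  equiv_one : equiv 1 P.one = Q.one
  equiv_comp : ∀ {l : ℕ} (n : Fin l → ℕ) (μ : P.obj l) (ν : ∀ i, P.obj (n i)),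
    equiv _ (P.comp n μ ν) = Q.comp n (equiv l μ) (fun i => equiv (n i) (ν i))

section Ideals

variable {k : Type u} [Field k]

/-- An operadic ideal. -/
structure Operad.Ideal (P : Operad.{u, v} k) where
  carrier : ∀ n, Submodule k (P.obj n)
  map_mem : ∀ {n m : ℕ} (e : Fin n ≃ Fin m) {x : P.obj n},
    x ∈ carrier n → P.map e x ∈ carrier m
  comp_mem_left : ∀ {l : ℕ} (n : Fin l → ℕ) {μ : P.obj l} (ν : ∀ i, P.obj (n i)),
    μ ∈ carrier l → P.comp n μ ν ∈ carrier (∑ i, n i)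
  comp_mem_right : ∀ {l : ℕ} (n : Fin l → ℕ) (μ : P.obj l) (ν : ∀ i, P.obj (n i)) (i : Fin l),
    ν i ∈ carrier (n i) → P.comp n μ ν ∈ carrier (∑ i, n i)

/-- The smallest operadic ideal that contains a set of elements of various arities. -/
def Operad.idealSpan (P : Operad.{u, v} k) (R : Set (Σ n, P.obj n)) : P.Ideal where
  carrier n := ⨅ (I : P.Ideal) (_ : ∀ r ∈ R, r.2 ∈ I.carrier r.1), I.carrier n
  map_mem e x hx := by
    simp only [Submodule.mem_iInf] at hx ⊢
    exact fun I hI => I.map_mem e (hx I hI)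
  comp_mem_left n μ ν hx := by
    simp only [Submodule.mem_iInf] at hx ⊢
    exact fun I hI => I.comp_mem_left n ν (hx I hI)
  comp_mem_right n μ ν i hx := by
    simp only [Submodule.mem_iInf] at hx ⊢
    exact fun I hI => I.comp_mem_right n μ ν i (hx I hI)

theorem Operad.Ideal.comp_sub_mem {P : Operad.{u, v} k} (I : P.Ideal) {l : ℕ} (n : Fin l → ℕ)
    (μ μ' : P.obj l) (ν ν' : ∀ i, P.obj (n i)) (hμ : μ - μ' ∈ I.carrier l)
    (hν : ∀ i, ν i - ν' i ∈ I.carrier (n i)) :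
    P.comp n μ ν - P.comp n μ' ν' ∈ I.carrier (∑ i, n i) := by
  classical
  have key : ∀ s : Finset (Fin l),
      P.comp n μ' (s.piecewise ν ν') - P.comp n μ' ν' ∈ I.carrier (∑ i, n i) := by
    intro s
    induction s using Finset.induction_on with
    | empty => simp
    | insert a s ha ih =>
      have h1 : P.comp n μ' ((insert a s).piecewise ν ν') - P.comp n μ' (s.piecewise ν ν')
          ∈ I.carrier (∑ i, n i) := by
        have e1 : (insert a s).piecewise ν ν' = Function.update (s.piecewise ν ν') a (ν a) :=
          Finset.piecewise_insert ..
        have e2 : s.piecewise ν ν' = Function.update (s.piecewise ν ν') a (ν' a) := by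
          rw [eq_comm, Function.update_eq_self_iff]
          simp [ha]
        rw [e1]
        nth_rewrite 2 [e2]
        rw [← MultilinearMap.map_update_sub]
        refine I.comp_mem_right n μ' _ a ?_
        simpa using hν a
      have := Submodule.add_mem _ h1 ih
      simpa using this
  have h2 : P.comp n μ ν - P.comp n μ' ν ∈ I.carrier (∑ i, n i) := by
    have := I.comp_mem_left n ν hμ
    simpa using this
  have h3 := key Finset.univ
  rw [Finset.piecewise_univ] at h3
  have := Submodule.add_mem _ h2 h3
  simpa using this

namespace Operad.Ideal

variable {P : Operad.{u, v} k} (I : P.Ideal)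

/-- The composition of classes is the class of the composition of representatives. -/
noncomputable def quotComp {l : ℕ} (n : Fin l → ℕ) (μ : P.obj l ⧸ I.carrier l)
    (ν : ∀ i, P.obj (n i) ⧸ I.carrier (n i)) :
    P.obj (∑ i, n i) ⧸ I.carrier (∑ i, n i) :=
  Submodule.Quotient.mk (P.comp n (Quotient.out μ) (fun i => Quotient.out (ν i)))

theorem quotComp_mk {l : ℕ} (n : Fin l → ℕ) (μ : P.obj l) (ν : ∀ i, P.obj (n i)) :
    I.quotComp n (Submodule.Quotient.mk μ) (fun i => Submodule.Quotient.mk (ν i)) =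
      Submodule.Quotient.mk (P.comp n μ ν) := by
  refine (Submodule.Quotient.eq _).2 (I.comp_sub_mem n _ _ _ _ ?_ ?_)
  · exact (Submodule.Quotient.eq _).1 (Quotient.out_eq _)
  · exact fun i => (Submodule.Quotient.eq _).1 (Quotient.out_eq _)

theorem exists_rep {l : ℕ} {n : Fin l → ℕ} (ν : ∀ i, P.obj (n i) ⧸ I.carrier (n i)) :
    ∃ ν' : ∀ i, P.obj (n i), ν = fun i => Submodule.Quotient.mk (ν' i) :=
  ⟨fun i => Quotient.out (ν i), funext fun i => (Quotient.out_eq (ν i)).symm⟩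

theorem update_mk {l : ℕ} {n : Fin l → ℕ} [DecidableEq (Fin l)] (ν : ∀ i, P.obj (n i))
    (i : Fin l) (x : P.obj (n i)) :
    Function.update (fun i => (Submodule.Quotient.mk (ν i) : P.obj (n i) ⧸ I.carrier (n i))) i
      (Submodule.Quotient.mk x) = fun j => Submodule.Quotient.mk (Function.update ν i x j) := by
  funext j
  by_cases h : j = i
  · subst h; simp
  · simp [h]

/-- The composition of the quotient as a multilinear map. -/
noncomputable def quotCompHom {l : ℕ} (n : Fin l → ℕ) :
    (P.obj l ⧸ I.carrier l) →ₗ[k] MultilinearMap k (fun i => P.obj (n i) ⧸ I.carrier (n i))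
      (P.obj (∑ i, n i) ⧸ I.carrier (∑ i, n i)) where
  toFun μ :=
    { toFun := fun ν => I.quotComp n μ ν
      map_update_add' := by
        intro _ ν i x y
        obtain ⟨ν, rfl⟩ := I.exists_rep ν
        obtain ⟨μ, rfl⟩ := Submodule.Quotient.mk_surjective _ μ
        obtain ⟨x, rfl⟩ := Submodule.Quotient.mk_surjective _ x
        obtain ⟨y, rfl⟩ := Submodule.Quotient.mk_surjective _ y
        rw [← Submodule.Quotient.mk_add, update_mk, update_mk, update_mk, quotComp_mk,
          quotComp_mk, quotComp_mk]
        exact congrArg _ (MultilinearMap.map_update_add _ _ _ _ _)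
      map_update_smul' := by
        intro _ ν i c x
        obtain ⟨ν, rfl⟩ := I.exists_rep ν
        obtain ⟨μ, rfl⟩ := Submodule.Quotient.mk_surjective _ μ
        obtain ⟨x, rfl⟩ := Submodule.Quotient.mk_surjective _ x
        rw [← Submodule.Quotient.mk_smul, update_mk, update_mk, quotComp_mk, quotComp_mk]
        exact congrArg _ (MultilinearMap.map_update_smul _ _ _ _ _) }
  map_add' μ μ' := by
    ext ν
    obtain ⟨ν, rfl⟩ := I.exists_rep ν
    obtain ⟨μ, rfl⟩ := Submodule.Quotient.mk_surjective _ μ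
    obtain ⟨μ', rfl⟩ := Submodule.Quotient.mk_surjective _ μ'
    rw [← Submodule.Quotient.mk_add]
    simp only [MultilinearMap.coe_mk, add_apply]
    rw [quotComp_mk, quotComp_mk, quotComp_mk, map_add]
    rfl
  map_smul' c μ := by
    ext ν
    obtain ⟨ν, rfl⟩ := I.exists_rep ν
    obtain ⟨μ, rfl⟩ := Submodule.Quotient.mk_surjective _ μ
    rw [← Submodule.Quotient.mk_smul]
    simp only [MultilinearMap.coe_mk, smul_apply, RingHom.id_apply]
    rw [quotComp_mk, quotComp_mk, map_smul]
    rfl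

theorem quotCompHom_mk {l : ℕ} (n : Fin l → ℕ) (μ : P.obj l) (ν : ∀ i, P.obj (n i)) :
    I.quotCompHom n (Submodule.Quotient.mk μ) (fun i => Submodule.Quotient.mk (ν i)) =
      Submodule.Quotient.mk (P.comp n μ ν) :=
  I.quotComp_mk n μ ν

/-- The quotient operad `P / I`. -/
noncomputable def quotient : Operad.{u, v} k where
  obj n := P.obj n ⧸ I.carrier n
  map e := Submodule.mapQ _ _ (P.map e) (fun _ hx => I.map_mem e hx)
  one := Submodule.Quotient.mk P.one
  comp n := I.quotCompHom n
  map_refl x := by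
    obtain ⟨x, rfl⟩ := Submodule.Quotient.mk_surjective _ x
    rw [Submodule.mapQ_apply, P.map_refl]
  map_trans e f x := by
    obtain ⟨x, rfl⟩ := Submodule.Quotient.mk_surjective _ x
    rw [Submodule.mapQ_apply, Submodule.mapQ_apply, Submodule.mapQ_apply, P.map_trans]
  comp_map_right {l n n'} σ μ ν := by
    obtain ⟨ν, rfl⟩ := I.exists_rep ν
    obtain ⟨μ, rfl⟩ := Submodule.Quotient.mk_surjective _ μ
    refine (I.quotCompHom_mk n' μ (fun i => P.map (σ i) (ν i))).trans ?_
    rw [quotCompHom_mk, Submodule.mapQ_apply, P.comp_map_right]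
  comp_map_left {l l'} σ n μ ν := by
    obtain ⟨ν, rfl⟩ := I.exists_rep ν
    obtain ⟨μ, rfl⟩ := Submodule.Quotient.mk_surjective _ μ
    refine (I.quotCompHom_mk n (P.map σ μ) ν).trans ?_
    rw [I.quotCompHom_mk (fun i => n (σ i)) μ (fun i => ν (σ i)), Submodule.mapQ_apply,
      P.comp_map_left]
  comp_assoc {l} n m μ ν ξ := by
    obtain ⟨ν, rfl⟩ := I.exists_rep ν
    obtain ⟨μ, rfl⟩ := Submodule.Quotient.mk_surjective _ μ
    obtain ⟨ξ, rfl⟩ : ∃ ξ' : ∀ i j, P.obj (m i j),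
        ξ = fun i j => Submodule.Quotient.mk (ξ' i j) :=
      ⟨fun i j => Quotient.out (ξ i j),
        funext fun i => funext fun j => (Quotient.out_eq (ξ i j)).symm⟩
    beta_reduce
    rw [I.quotCompHom_mk n μ ν, I.quotCompHom_mk (flatten m) (P.comp n μ ν)
      (fun p => ξ (finSigmaFinEquiv.symm p).1 (finSigmaFinEquiv.symm p).2),
      Submodule.mapQ_apply, P.comp_assoc]
    have h : (fun i => I.quotCompHom (m i) (Submodule.Quotient.mk (ν i))
        (fun j => Submodule.Quotient.mk (ξ i j))) =
        fun i => Submodule.Quotient.mk (P.comp (m i) (ν i) (ξ i)) :=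
      funext fun i => I.quotCompHom_mk (m i) (ν i) (ξ i)
    rw [h]
    exact (I.quotCompHom_mk (fun i => ∑ j, m i j) μ
      (fun i => P.comp (m i) (ν i) (ξ i))).symm
  one_comp n ν := by
    obtain ⟨ν, rfl⟩ := I.exists_rep ν
    rw [I.quotCompHom_mk, P.one_comp, Submodule.mapQ_apply]
  comp_one {l} μ := by
    obtain ⟨μ, rfl⟩ := Submodule.Quotient.mk_surjective _ μ
    rw [I.quotCompHom_mk (fun _ => 1) μ (fun _ => P.one), P.comp_one, Submodule.mapQ_apply]

end Operad.Ideal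

end Ideals

section FreeOperad

/-- Formal expressions built from binary generators `v : V` by means of the operations of an
operad. -/
inductive Term (k : Type u) (V : Type v) : ℕ → Type (max u v)
  | gen (v : V) : Term k V 2
  | one : Term k V 1
  | zero (n : ℕ) : Term k V n
  | add {n : ℕ} (x y : Term k V n) : Term k V n
  | smul {n : ℕ} (c : k) (x : Term k V n) : Term k V n
  | map {n m : ℕ} (e : Fin n ≃ Fin m) (x : Term k V n) : Term k V m
  | comp {l : ℕ} (n : Fin l → ℕ) (μ : Term k V l) (ν : ∀ i, Term k V (n i)) :
      Term k V (∑ i, n i)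

variable {k : Type u} [Field k] {V : Type v} [AddCommGroup V] [Module k V]

/-- The equalities between formal expressions that hold in every operad in which `V` is linearly
mapped to the binary operations, `τ : V → V` being the action of the transposition: the
congruence generated by the laws of vector spaces and operads, the linearity of `gen` and its
equivariance. -/
inductive Term.Rel (τ : V →ₗ[k] V) : ∀ {n : ℕ}, Term k V n → Term k V n → Prop
  -- equivalence relation
  | refl {n : ℕ} (x : Term k V n) : Rel τ x x
  | symm {n : ℕ} {x y : Term k V n} : Rel τ x y → Rel τ y x
  | trans {n : ℕ} {x y z : Term k V n} : Rel τ x y → Rel τ y z → Rel τ x z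
  -- congruence
  | add_congr {n : ℕ} {x x' y y' : Term k V n} :
      Rel τ x x' → Rel τ y y' → Rel τ (x.add y) (x'.add y')
  | smul_congr {n : ℕ} (c : k) {x x' : Term k V n} :
      Rel τ x x' → Rel τ (x.smul c) (x'.smul c)
  | map_congr {n m : ℕ} (e : Fin n ≃ Fin m) {x x' : Term k V n} :
      Rel τ x x' → Rel τ (x.map e) (x'.map e)
  | comp_congr {l : ℕ} (n : Fin l → ℕ) {μ μ' : Term k V l} {ν ν' : ∀ i, Term k V (n i)} :
      Rel τ μ μ' → (∀ i, Rel τ (ν i) (ν' i)) → Rel τ (μ.comp n ν) (μ'.comp n ν')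
  -- vector spaces
  | add_comm {n : ℕ} (x y : Term k V n) : Rel τ (x.add y) (y.add x)
  | add_assoc {n : ℕ} (x y z : Term k V n) : Rel τ ((x.add y).add z) (x.add (y.add z))
  | zero_add {n : ℕ} (x : Term k V n) : Rel τ ((zero n).add x) x
  | zero_smul {n : ℕ} (x : Term k V n) : Rel τ (x.smul 0) (zero n)
  | one_smul {n : ℕ} (x : Term k V n) : Rel τ (x.smul 1) x
  | mul_smul {n : ℕ} (c d : k) (x : Term k V n) : Rel τ (x.smul (c * d)) ((x.smul d).smul c)
  | add_smul {n : ℕ} (c d : k) (x : Term k V n) :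
      Rel τ (x.smul (c + d)) ((x.smul c).add (x.smul d))
  | smul_add {n : ℕ} (c : k) (x y : Term k V n) :
      Rel τ ((x.add y).smul c) ((x.smul c).add (y.smul c))
  -- linearity of the actions and of the compositions
  | map_add {n m : ℕ} (e : Fin n ≃ Fin m) (x y : Term k V n) :
      Rel τ ((x.add y).map e) ((x.map e).add (y.map e))
  | map_smul {n m : ℕ} (e : Fin n ≃ Fin m) (c : k) (x : Term k V n) :
      Rel τ ((x.smul c).map e) ((x.map e).smul c)
  | comp_add_left {l : ℕ} (n : Fin l → ℕ) (μ μ' : Term k V l) (ν : ∀ i, Term k V (n i)) :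
      Rel τ ((μ.add μ').comp n ν) ((μ.comp n ν).add (μ'.comp n ν))
  | comp_smul_left {l : ℕ} (n : Fin l → ℕ) (c : k) (μ : Term k V l) (ν : ∀ i, Term k V (n i)) :
      Rel τ ((μ.smul c).comp n ν) ((μ.comp n ν).smul c)
  | comp_add_right {l : ℕ} (n : Fin l → ℕ) (μ : Term k V l) (ν : ∀ i, Term k V (n i))
      (i : Fin l) (x y : Term k V (n i)) :
      Rel τ (μ.comp n (Function.update ν i (x.add y)))
        ((μ.comp n (Function.update ν i x)).add (μ.comp n (Function.update ν i y)))
  | comp_smul_right {l : ℕ} (n : Fin l → ℕ) (μ : Term k V l) (ν : ∀ i, Term k V (n i))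
      (i : Fin l) (c : k) (x : Term k V (n i)) :
      Rel τ (μ.comp n (Function.update ν i (x.smul c)))
        ((μ.comp n (Function.update ν i x)).smul c)
  -- the laws of operads
  | map_refl {n : ℕ} (x : Term k V n) : Rel τ (x.map (Equiv.refl (Fin n))) x
  | map_trans {n m p : ℕ} (e : Fin n ≃ Fin m) (f : Fin m ≃ Fin p) (x : Term k V n) :
      Rel τ (x.map (e.trans f)) ((x.map e).map f)
  | comp_map_right {l : ℕ} {n n' : Fin l → ℕ} (σ : ∀ i, Fin (n i) ≃ Fin (n' i))
      (μ : Term k V l) (ν : ∀ i, Term k V (n i)) :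
      Rel τ (μ.comp n' (fun i => (ν i).map (σ i))) ((μ.comp n ν).map (sumEquiv σ))
  | comp_map_left {l l' : ℕ} (σ : Fin l ≃ Fin l') (n : Fin l' → ℕ)
      (μ : Term k V l) (ν : ∀ i, Term k V (n i)) :
      Rel τ ((μ.map σ).comp n ν)
        ((μ.comp (fun i => n (σ i)) (fun i => ν (σ i))).map (blockEquiv σ n))
  | comp_assoc {l : ℕ} (n : Fin l → ℕ) (m : ∀ i, Fin (n i) → ℕ)
      (μ : Term k V l) (ν : ∀ i, Term k V (n i)) (ξ : ∀ i j, Term k V (m i j)) :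
      Rel τ
        (((μ.comp n ν).comp (flatten m)
          (fun p => ξ (finSigmaFinEquiv.symm p).1 (finSigmaFinEquiv.symm p).2)).map
            (assocEquiv n m))
        (μ.comp (fun i => ∑ j, m i j) (fun i => (ν i).comp (m i) (ξ i)))
  | one_comp (n : Fin 1 → ℕ) (ν : ∀ i, Term k V (n i)) :
      Rel τ (one.comp n ν) ((ν 0).map (unitEquivLeft n))
  | comp_one {l : ℕ} (μ : Term k V l) :
      Rel τ (μ.comp (fun _ => 1) (fun _ => one)) (μ.map (unitEquivRight l))
  -- the generators
  | gen_add (v w : V) : Rel τ (gen (v + w)) ((gen v).add (gen w))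
  | gen_smul (c : k) (v : V) : Rel τ (gen (c • v)) ((gen v).smul c)
  | gen_swap (v : V) : Rel τ (gen (τ v)) ((gen v).map (Equiv.swap 0 1))

/-- Equality of formal expressions in the free operad. -/
def Term.setoid (τ : V →ₗ[k] V) (n : ℕ) : Setoid (Term k V n) where
  r x y := Term.Rel τ x y
  iseqv := ⟨Term.Rel.refl, Term.Rel.symm, Term.Rel.trans⟩

/-- The component of arity `n` of the free operad on `(V, τ)`. -/
def FreeObj (τ : V →ₗ[k] V) (n : ℕ) : Type (max u v) := Quotient (Term.setoid τ n)

namespace FreeObj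

variable (τ : V →ₗ[k] V)

/-- The class of a formal expression. -/
def mk {n : ℕ} (x : Term k V n) : FreeObj τ n := Quotient.mk (Term.setoid τ n) x

variable {τ}

theorem sound {n : ℕ} {x y : Term k V n} (h : Term.Rel τ x y) : mk τ x = mk τ y :=
  Quotient.sound (s := Term.setoid τ n) h

theorem mk_surjective {n : ℕ} (x : FreeObj τ n) : ∃ y, mk τ y = x :=
  Quotient.exists_rep x

theorem rel_out {n : ℕ} (x : Term k V n) : Term.Rel τ (Quotient.out (mk τ x)) x :=
  Quotient.mk_out (s := Term.setoid τ n) x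

instance (n : ℕ) : Add (FreeObj τ n) :=
  ⟨Quotient.map₂ Term.add fun _ _ h _ _ h' => Term.Rel.add_congr h h'⟩

instance (n : ℕ) : Zero (FreeObj τ n) := ⟨mk τ (Term.zero n)⟩

instance (n : ℕ) : SMul k (FreeObj τ n) :=
  ⟨fun c => Quotient.map (Term.smul c) fun _ _ h => Term.Rel.smul_congr c h⟩

theorem mk_add {n : ℕ} (x y : Term k V n) : mk τ (x.add y) = mk τ x + mk τ y := rfl

theorem mk_zero (n : ℕ) : mk τ (Term.zero n) = 0 := rfl

theorem mk_smul {n : ℕ} (c : k) (x : Term k V n) : mk τ (x.smul c) = c • mk τ x := rfl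

instance (n : ℕ) : Neg (FreeObj τ n) := ⟨fun x => (-1 : k) • x⟩

theorem smul_zero_left {n : ℕ} (x : FreeObj τ n) : (0 : k) • x = 0 := by
  obtain ⟨x, rfl⟩ := mk_surjective x
  exact sound (.zero_smul x)

theorem smul_one_left {n : ℕ} (x : FreeObj τ n) : (1 : k) • x = x := by
  obtain ⟨x, rfl⟩ := mk_surjective x
  exact sound (.one_smul x)

theorem smul_add_left {n : ℕ} (c d : k) (x : FreeObj τ n) : (c + d) • x = c • x + d • x := by
  obtain ⟨x, rfl⟩ := mk_surjective x
  exact sound (.add_smul c d x)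

theorem add_comm' {n : ℕ} (x y : FreeObj τ n) : x + y = y + x := by
  obtain ⟨x, rfl⟩ := mk_surjective x
  obtain ⟨y, rfl⟩ := mk_surjective y
  exact sound (.add_comm x y)

theorem zero_add' {n : ℕ} (x : FreeObj τ n) : 0 + x = x := by
  obtain ⟨x, rfl⟩ := mk_surjective x
  exact sound (.zero_add x)

instance (n : ℕ) : AddCommGroup (FreeObj τ n) where
  add_assoc x y z := by
    obtain ⟨x, rfl⟩ := mk_surjective x
    obtain ⟨y, rfl⟩ := mk_surjective y
    obtain ⟨z, rfl⟩ := mk_surjective z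
    exact sound (.add_assoc x y z)
  zero_add := zero_add'
  add_zero x := by rw [add_comm', zero_add']
  add_comm := add_comm'
  neg_add_cancel x := by
    change (-1 : k) • x + x = 0
    nth_rewrite 2 [← smul_one_left x]
    rw [← smul_add_left, neg_add_cancel, smul_zero_left]
  nsmul := nsmulRec
  zsmul := zsmulRec

instance (n : ℕ) : Module k (FreeObj τ n) where
  one_smul := smul_one_left
  mul_smul c d x := by
    obtain ⟨x, rfl⟩ := mk_surjective x
    exact sound (.mul_smul c d x)
  smul_zero c := by
    rw [← smul_zero_left (0 : FreeObj τ n)]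
    have := sound (τ := τ) (.mul_smul c 0 (Term.zero n))
    rw [mul_zero] at this
    exact this.symm
  smul_add c x y := by
    obtain ⟨x, rfl⟩ := mk_surjective x
    obtain ⟨y, rfl⟩ := mk_surjective y
    exact sound (.smul_add c x y)
  add_smul := smul_add_left
  zero_smul := smul_zero_left

/-- The action of bijections on classes. -/
def mapHom {n m : ℕ} (e : Fin n ≃ Fin m) : FreeObj τ n →ₗ[k] FreeObj τ m where
  toFun := Quotient.map (Term.map e) fun _ _ h => Term.Rel.map_congr e h
  map_add' x y := by
    obtain ⟨x, rfl⟩ := mk_surjective x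
    obtain ⟨y, rfl⟩ := mk_surjective y
    exact sound (.map_add e x y)
  map_smul' c x := by
    obtain ⟨x, rfl⟩ := mk_surjective x
    exact sound (.map_smul e c x)

theorem mapHom_mk {n m : ℕ} (e : Fin n ≃ Fin m) (x : Term k V n) :
    mapHom e (mk τ x) = mk τ (x.map e) := rfl

/-- The composition of classes is the class of the composition of representatives. -/
noncomputable def compFun {l : ℕ} (n : Fin l → ℕ) (μ : FreeObj τ l)
    (ν : ∀ i, FreeObj τ (n i)) : FreeObj τ (∑ i, n i) :=
  mk τ ((Quotient.out μ).comp n (fun i => Quotient.out (ν i)))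

theorem compFun_mk {l : ℕ} (n : Fin l → ℕ) (μ : Term k V l) (ν : ∀ i, Term k V (n i)) :
    compFun n (mk τ μ) (fun i => mk τ (ν i)) = mk τ (μ.comp n ν) :=
  sound (.comp_congr n (rel_out μ) (fun i => rel_out (ν i)))

theorem exists_rep {l : ℕ} {n : Fin l → ℕ} (ν : ∀ i, FreeObj τ (n i)) :
    ∃ ν' : ∀ i, Term k V (n i), ν = fun i => mk τ (ν' i) :=
  ⟨fun i => Quotient.out (ν i), funext fun i => (Quotient.out_eq (ν i)).symm⟩

theorem update_mk {l : ℕ} {n : Fin l → ℕ} (ν : ∀ i, Term k V (n i))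
    (i : Fin l) (x : Term k V (n i)) :
    Function.update (fun i => mk τ (ν i)) i (mk τ x) =
      fun j => mk τ (Function.update ν i x j) := by
  funext j
  by_cases h : j = i
  · subst h; simp
  · simp [h]

/-- The composition of the free operad as a multilinear map. -/
noncomputable def compHom {l : ℕ} (n : Fin l → ℕ) :
    FreeObj τ l →ₗ[k] MultilinearMap k (fun i => FreeObj τ (n i)) (FreeObj τ (∑ i, n i)) where
  toFun μ :=
    { toFun := fun ν => compFun n μ ν
      map_update_add' := by
        intro inst ν i x y
        obtain rfl : inst = instDecidableEqFin l := Subsingleton.elim _ _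
        obtain ⟨ν, rfl⟩ := exists_rep ν
        obtain ⟨μ, rfl⟩ := mk_surjective μ
        obtain ⟨x, rfl⟩ := mk_surjective x
        obtain ⟨y, rfl⟩ := mk_surjective y
        rw [← mk_add, update_mk, update_mk, update_mk, compFun_mk, compFun_mk, compFun_mk]
        exact sound (.comp_add_right n μ ν i x y)
      map_update_smul' := by
        intro inst ν i c x
        obtain rfl : inst = instDecidableEqFin l := Subsingleton.elim _ _
        obtain ⟨ν, rfl⟩ := exists_rep ν
        obtain ⟨μ, rfl⟩ := mk_surjective μ
        obtain ⟨x, rfl⟩ := mk_surjective x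
        rw [← mk_smul, update_mk, update_mk, compFun_mk, compFun_mk]
        exact sound (.comp_smul_right n μ ν i c x) }
  map_add' μ μ' := by
    ext ν
    obtain ⟨ν, rfl⟩ := exists_rep ν
    obtain ⟨μ, rfl⟩ := mk_surjective μ
    obtain ⟨μ', rfl⟩ := mk_surjective μ'
    rw [← mk_add]
    simp only [MultilinearMap.coe_mk, add_apply]
    rw [compFun_mk, compFun_mk, compFun_mk]
    exact sound (.comp_add_left n μ μ' ν)
  map_smul' c μ := by
    ext ν
    obtain ⟨ν, rfl⟩ := exists_rep ν
    obtain ⟨μ, rfl⟩ := mk_surjective μ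
    rw [← mk_smul]
    simp only [MultilinearMap.coe_mk, smul_apply, RingHom.id_apply]
    rw [compFun_mk, compFun_mk]
    exact sound (.comp_smul_left n c μ ν)

theorem compHom_mk {l : ℕ} (n : Fin l → ℕ) (μ : Term k V l) (ν : ∀ i, Term k V (n i)) :
    compHom n (mk τ μ) (fun i => mk τ (ν i)) = mk τ (μ.comp n ν) :=
  compFun_mk n μ ν

end FreeObj

open FreeObj in
/-- The free operad `𝒯(M)` on the `𝕊`-module `M = (0, 0, V, 0, …)` in which the transposition
acts on `V` by `τ`. -/
noncomputable def freeOperad (τ : V →ₗ[k] V) : Operad.{u, max u v} k where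
  obj n := FreeObj τ n
  map e := mapHom e
  one := mk τ Term.one
  comp n := compHom n
  map_refl x := by
    obtain ⟨x, rfl⟩ := mk_surjective x
    exact sound (.map_refl x)
  map_trans e f x := by
    obtain ⟨x, rfl⟩ := mk_surjective x
    exact sound (.map_trans e f x)
  comp_map_right {l n n'} σ μ ν := by
    obtain ⟨ν, rfl⟩ := exists_rep ν
    obtain ⟨μ, rfl⟩ := mk_surjective μ
    rw [compHom_mk]
    exact (compHom_mk n' μ (fun i => (ν i).map (σ i))).trans (sound (.comp_map_right σ μ ν))
  comp_map_left {l l'} σ n μ ν := by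
    obtain ⟨ν, rfl⟩ := exists_rep ν
    obtain ⟨μ, rfl⟩ := mk_surjective μ
    rw [compHom_mk (fun i => n (σ i)) μ (fun i => ν (σ i))]
    exact (compHom_mk n (μ.map σ) ν).trans (sound (.comp_map_left σ n μ ν))
  comp_assoc {l} n m μ ν ξ := by
    obtain ⟨ν, rfl⟩ := exists_rep ν
    obtain ⟨μ, rfl⟩ := mk_surjective μ
    obtain ⟨ξ, rfl⟩ : ∃ ξ' : ∀ i j, Term k V (m i j), ξ = fun i j => mk τ (ξ' i j) :=
      ⟨fun i j => Quotient.out (ξ i j),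
        funext fun i => funext fun j => (Quotient.out_eq (ξ i j)).symm⟩
    beta_reduce
    have h : (fun i => compHom (m i) (mk τ (ν i)) (fun j => mk τ (ξ i j))) =
        fun i => mk τ ((ν i).comp (m i) (ξ i)) :=
      funext fun i => compHom_mk (m i) (ν i) (ξ i)
    rw [h, compHom_mk n μ ν, compHom_mk (flatten m) (μ.comp n ν)
      (fun p => ξ (finSigmaFinEquiv.symm p).1 (finSigmaFinEquiv.symm p).2)]
    exact (sound (.comp_assoc n m μ ν ξ)).trans (compHom_mk _ μ _).symm
  one_comp n ν := by
    obtain ⟨ν, rfl⟩ := exists_rep ν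
    rw [compHom_mk]
    exact sound (.one_comp n ν)
  comp_one {l} μ := by
    obtain ⟨μ, rfl⟩ := mk_surjective μ
    exact (compHom_mk (fun _ => 1) μ (fun _ => Term.one)).trans (sound (.comp_one μ))

/-- The generators as binary operations of the free operad. -/
noncomputable def freeGen (τ : V →ₗ[k] V) : V →ₗ[k] (freeOperad τ).obj 2 where
  toFun v := FreeObj.mk τ (Term.gen v)
  map_add' v w := FreeObj.sound (.gen_add v w)
  map_smul' c v := FreeObj.sound (.gen_smul c v)

end FreeOperad

section Trees

variable {k : Type u} [Field k]

/-- The arities of the two inputs of the root in a tree of the shape `((1, 2), 3)`. -/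
abbrev treeArity : Fin 2 → ℕ := ![2, 1]

/-- The cyclic renaming of the leaves `0 ↦ i + 1`, `1 ↦ i + 2`, `2 ↦ i` (modulo three); the leaves
`1, 2, 3` of a tree are the elements `0, 1, 2` of `Fin 3`. -/
def treeLeaves (i : Fin 3) : Fin (∑ j, treeArity j) ≃ Fin 3 :=
  (finCongr (by decide)).trans (Equiv.addRight (i + 1))

/-- The two inputs of the root: the operation `μ` and a leaf. -/
def Operad.treeInputs (P : Operad.{u, v} k) (μ : P.obj 2) : ∀ j, P.obj (treeArity j)
  | 0 => μ
  | 1 => P.one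

theorem Operad.treeInputs_eq (P : Operad.{u, v} k) (μ μ' : P.obj 2) :
    P.treeInputs μ = Function.update (P.treeInputs μ') 0 μ := by
  funext j
  fin_cases j <;> rfl

/-- The composite `ν(μ(i + 1, i + 2), i)` of two binary operations, with `μ` above the root `ν`:
the leaf `i : Fin 3` is attached to the root, and the other two follow it in cyclic order.  With
the usual labels `1, 2, 3` of the leaves the three trees are `((1, 2), 3)` for `i = 2`, `((2, 3), 1)` for `i = 0` and `((3, 1), 2)` for `i = 1`. -/
def Operad.tree (P : Operad.{u, v} k) (i : Fin 3) : P.obj 2 →ₗ[k] P.obj 2 →ₗ[k] P.obj 3 :=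
  LinearMap.mk₂ k (fun μ ν => P.map (treeLeaves i) (P.comp treeArity ν (P.treeInputs μ)))
    (fun μ μ' ν => by
      rw [P.treeInputs_eq (μ + μ') 0, P.treeInputs_eq μ 0, P.treeInputs_eq μ' 0,
        ← _root_.map_add]
      exact congrArg _ (MultilinearMap.map_update_add _ _ _ _ _))
    (fun c μ ν => by
      rw [P.treeInputs_eq (c • μ) 0, P.treeInputs_eq μ 0, ← _root_.map_smul]
      exact congrArg _ (MultilinearMap.map_update_smul _ _ _ _ _))
    (fun μ ν ν' => by
      rw [_root_.map_add, add_apply, _root_.map_add])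
    (fun c μ ν => by
      rw [_root_.map_smul, smul_apply, _root_.map_smul])

variable (k) in
/-- The space `𝒯(M)(3)` for `M` concentrated in arity two with `M(2) = V`: three copies of
`V ⊗ V`, one for each of the three trees of `Operad.tree`.  In `V ⊗ V` the first factor
decorates the upper vertex and the second factor decorates the root. -/
abbrev TreeSpace (V : Type v) [AddCommGroup V] [Module k V] : Type v :=
  Fin 3 → V ⊗[k] V

variable {V : Type v} [AddCommGroup V] [Module k V] {W : Type w} [AddCommGroup W] [Module k W]

/-- The element of the free operad described by an element of `TreeSpace k V`. -/
noncomputable def treeMap (τ : V →ₗ[k] V) : TreeSpace k V →ₗ[k] (freeOperad τ).obj 3 :=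
  ∑ i, (TensorProduct.lift (((freeOperad τ).tree i).compl₁₂ (freeGen τ) (freeGen τ))) ∘ₗ
    LinearMap.proj i

/-- The action of a permutation of the leaves.  The tree with leaf `i` at the root goes to the
tree with leaf `σ i` at the root; an odd `σ` reverses the cyclic order of the leaves, so that
the inputs of the upper vertex have to be exchanged. -/
noncomputable def treePerm (τ : V →ₗ[k] V) (σ : Equiv.Perm (Fin 3)) :
    TreeSpace k V →ₗ[k] TreeSpace k V :=
  LinearMap.pi fun i =>
    (if Equiv.Perm.sign σ = 1 then LinearMap.id else TensorProduct.map τ LinearMap.id) ∘ₗ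
      LinearMap.proj (σ.symm i)

end Trees

section QuadraticData

/-- A binary quadratic presentation `𝒯(M)/⟨R⟩` with `M` concentrated in arity two: the space
`M(2) = V` with the action `swap` of the transposition, and the `𝕊`-module of quadratic relations
`R ⊆ 𝒯(M)(3)`. -/
structure BinaryQuadratic (k : Type u) [Field k] (V : Type v) [AddCommGroup V] [Module k V] where
  swap : V →ₗ[k] V
  swap_swap : ∀ v, swap (swap v) = v
  rel : Submodule k (TreeSpace k V)
  rel_stable : ∀ (σ : Equiv.Perm (Fin 3)), ∀ r ∈ rel, treePerm swap σ r ∈ rel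

namespace BinaryQuadratic

variable {k : Type u} [Field k] {V : Type v} [AddCommGroup V] [Module k V]
  {W : Type w} [AddCommGroup W] [Module k W]

/-- The binary quadratic operad `𝒯(M)/⟨R⟩`. -/
noncomputable def operad (P : BinaryQuadratic k V) : Operad.{u, max u v} k :=
  ((freeOperad P.swap).idealSpan
    {p | ∃ r ∈ P.rel, p = ⟨3, treeMap P.swap r⟩}).quotient

/-- Colouring of the vertices of all trees: the root, which is the first vertex in preorder, gets
the colour `c 0`, and the upper vertex, which is the second one, gets the colour `c 1`. -/
noncomputable def colour {Ω : Type w} (c : Fin 2 → Ω) :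
    TreeSpace k V →ₗ[k] TreeSpace k (Ω →₀ V) :=
  LinearMap.pi fun i =>
    TensorProduct.map (Finsupp.lsingle (c 1)) (Finsupp.lsingle (c 0)) ∘ₗ LinearMap.proj i

theorem treePerm_colour {Ω : Type w} (τ : V →ₗ[k] V) (σ : Equiv.Perm (Fin 3)) (c : Fin 2 → Ω)
    (x : TreeSpace k V) :
    treePerm (Finsupp.mapRange.linearMap τ) σ (colour c x) = colour c (treePerm τ σ x) := by
  funext i
  simp only [treePerm, colour, LinearMap.pi_apply, LinearMap.comp_apply, LinearMap.proj_apply]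
  split_ifs
  · rfl
  · generalize x (σ.symm i) = y
    induction y with
    | zero => simp
    | add a b ha hb => simp only [map_add, ha, hb]
    | tmul a b => simp

/-- The leveled matching operad with parameters `Ω`, by its presentation: the generators are
`⨁ ω ∈ Ω, M_ω`, where the replica `x_ω` of `x` is `Finsupp.single ω x`, and the relations are
spanned by all `r` in `R` with a colour given to each level simultaneously in all trees of `r`. -/
noncomputable def leveledMatching (Ω : Type w) (P : BinaryQuadratic k V) :
    BinaryQuadratic k (Ω →₀ V) where
  swap := Finsupp.mapRange.linearMap P.swap
  swap_swap f := by
    ext ω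
    simp [P.swap_swap]
  rel := Submodule.span k {s | ∃ r ∈ P.rel, ∃ c : Fin 2 → Ω, s = colour c r}
  rel_stable σ s hs := by
    induction hs using Submodule.span_induction with
    | mem s hs =>
      obtain ⟨r, hr, c, rfl⟩ := hs
      rw [treePerm_colour]
      exact Submodule.subset_span ⟨_, P.rel_stable σ r hr, c, rfl⟩
    | zero => simp
    | add x y _ _ hx hy => rw [map_add]; exact add_mem hx hy
    | smul a x _ hx => rw [map_smul]; exact Submodule.smul_mem _ _ hx

/-- The product of the decorations of two copies of the same tree, vertex by vertex. -/
noncomputable def treeProd : TreeSpace k V →ₗ[k] TreeSpace k W →ₗ[k] TreeSpace k (V ⊗[k] W) :=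
  LinearMap.mk₂ k
    (fun x y i => TensorProduct.tensorTensorTensorComm k V V W W (x i ⊗ₜ[k] y i))
    (fun x x' y => by funext i; simp [TensorProduct.add_tmul])
    (fun c x y => by
      funext i
      rw [Pi.smul_apply, Pi.smul_apply, ← TensorProduct.smul_tmul', map_smul])
    (fun x y y' => by funext i; simp [TensorProduct.tmul_add])
    (fun c x y => by funext i; simp)

theorem treePerm_treeProd_even {τ : V →ₗ[k] V} {τ' : W →ₗ[k] W} {τ'' : V ⊗[k] W →ₗ[k] V ⊗[k] W}
    {σ : Equiv.Perm (Fin 3)} (h : Equiv.Perm.sign σ = 1) (x : TreeSpace k V)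
    (y : TreeSpace k W) :
    treePerm τ'' σ (treeProd x y) = treeProd (treePerm τ σ x) (treePerm τ' σ y) := by
  funext i
  simp [treePerm, treeProd, h]

theorem treePerm_treeProd_odd {τ : V →ₗ[k] V} {τ' : W →ₗ[k] W}
    {σ : Equiv.Perm (Fin 3)} (h : Equiv.Perm.sign σ ≠ 1) (x : TreeSpace k V)
    (y : TreeSpace k W) :
    treePerm (-TensorProduct.map τ τ') σ (treeProd x y) =
      -treeProd (treePerm τ σ x) (treePerm τ' σ y) := by
  funext i
  simp only [treePerm, treeProd, h, LinearMap.pi_apply, LinearMap.comp_apply,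
    LinearMap.proj_apply, LinearMap.mk₂_apply, if_false, Pi.neg_apply]
  generalize x (σ.symm i) = x
  generalize y (σ.symm i) = y
  induction x with
  | zero => simp
  | add a b ha hb => simp only [TensorProduct.add_tmul, map_add, ha, hb, neg_add]
  | tmul a b =>
    induction y with
    | zero => simp
    | add a b ha hb => simp only [TensorProduct.tmul_add, map_add, ha, hb, neg_add]
    | tmul c d => simp [TensorProduct.neg_tmul]

/-- The Manin black product: the generators are `M(2) ⊗ N(2) ⊗ sgn`, and the relations are
spanned by the products `Ψ(r, s)` of a relation `r` of `P` and a relation `s` of `Q`, taken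
vertex by vertex on equal trees (products of different trees being zero). -/
noncomputable def black (P : BinaryQuadratic k V) (Q : BinaryQuadratic k W) :
    BinaryQuadratic k (V ⊗[k] W) where
  swap := -TensorProduct.map P.swap Q.swap
  swap_swap x := by
    induction x with
    | zero => simp
    | add a b ha hb => simpa only [map_add] using congrArg₂ (· + ·) ha hb
    | tmul a b => simp [P.swap_swap, Q.swap_swap]
  rel := Submodule.span k {t | ∃ r ∈ P.rel, ∃ s ∈ Q.rel, t = treeProd r s}
  rel_stable σ s hs := by
    induction hs using Submodule.span_induction with
    | mem s hs =>
      obtain ⟨r, hr, s, hs, rfl⟩ := hs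
      have hmem : treeProd (treePerm P.swap σ r) (treePerm Q.swap σ s) ∈
          Submodule.span k {t | ∃ r ∈ P.rel, ∃ s ∈ Q.rel, t = treeProd r s} :=
        Submodule.subset_span ⟨_, P.rel_stable σ r hr, _, Q.rel_stable σ s hs, rfl⟩
      by_cases h : Equiv.Perm.sign σ = 1
      · rw [treePerm_treeProd_even h]
        exact hmem
      · rw [treePerm_treeProd_odd h]
        exact neg_mem hmem
    | zero => simp
    | add x y _ _ hx hy => rw [map_add]; exact add_mem hx hy
    | smul a x _ hx => rw [map_smul]; exact Submodule.smul_mem _ _ hx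

/-- The map `Φ : 𝒯(M ⊗ N)(3) → 𝒯(M)(3) ⊗ 𝒯(N)(3)` that sends a tree whose vertices are decorated
by `μ ⊗ ν` and `μ' ⊗ ν'` to the tensor product of the same tree decorated by `μ`, `μ'` and the
same tree decorated by `ν`, `ν'`. -/
noncomputable def treeSplit :
    TreeSpace k (V ⊗[k] W) →ₗ[k] TreeSpace k V ⊗[k] TreeSpace k W :=
  ∑ i, TensorProduct.map (LinearMap.single k (fun _ : Fin 3 => V ⊗[k] V) i)
      (LinearMap.single k (fun _ : Fin 3 => W ⊗[k] W) i) ∘ₗ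
    (TensorProduct.tensorTensorTensorComm k V W V W).toLinearMap ∘ₗ LinearMap.proj i

theorem treeSplit_single (i : Fin 3) (a c : V) (b d : W) :
    treeSplit (k := k) (Pi.single i ((a ⊗ₜ b) ⊗ₜ (c ⊗ₜ d))) =
      Pi.single i (a ⊗ₜ c) ⊗ₜ[k] Pi.single i (b ⊗ₜ d) := by
  simp only [treeSplit, LinearMap.sum_apply, LinearMap.comp_apply, LinearMap.proj_apply]
  rw [Finset.sum_eq_single i]
  · simp
  · intro j _ hj
    simp [hj]
  · simp

theorem treePerm_single (τ : V →ₗ[k] V) (σ : Equiv.Perm (Fin 3)) (i : Fin 3) (a b : V) :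
    treePerm (k := k) τ σ (Pi.single i (a ⊗ₜ b)) =
      Pi.single (σ i) ((if Equiv.Perm.sign σ = 1 then a else τ a) ⊗ₜ b) := by
  funext j
  by_cases hj : j = σ i
  · subst hj
    simp only [treePerm, LinearMap.pi_apply, LinearMap.comp_apply, LinearMap.proj_apply]
    split_ifs <;> simp
  · have : σ.symm j ≠ i := fun h => hj (by simp [← h])
    simp [treePerm, hj, this]

theorem treeSplit_treePerm (τ : V →ₗ[k] V) (τ' : W →ₗ[k] W) (σ : Equiv.Perm (Fin 3))
    (x : TreeSpace k (V ⊗[k] W)) :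
    treeSplit (treePerm (TensorProduct.map τ τ') σ x) =
      TensorProduct.map (treePerm τ σ) (treePerm τ' σ) (treeSplit x) := by
  have h : treeSplit ∘ₗ treePerm (TensorProduct.map τ τ') σ =
      TensorProduct.map (treePerm τ σ) (treePerm τ' σ) ∘ₗ treeSplit := by
    refine LinearMap.pi_ext' fun i => ?_
    ext a b c d
    simp only [LinearMap.comp_apply, TensorProduct.AlgebraTensorModule.curry_apply,
      TensorProduct.curry_apply, LinearMap.coe_restrictScalars, LinearMap.coe_single]
    rw [treePerm_single, treeSplit_single, TensorProduct.map_tmul (treePerm τ σ),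
      treePerm_single, treePerm_single]
    split_ifs
    · rw [treeSplit_single]
    · rw [TensorProduct.map_tmul, treeSplit_single]
  exact LinearMap.congr_fun h x

/-- The Manin white product: the generators are `M(2) ⊗ N(2)`, and the relations are
`Φ⁻¹(R ⊗ 𝒯(N)(3) + 𝒯(M)(3) ⊗ S)`. -/
noncomputable def white (P : BinaryQuadratic k V) (Q : BinaryQuadratic k W) :
    BinaryQuadratic k (V ⊗[k] W) where
  swap := TensorProduct.map P.swap Q.swap
  swap_swap x := by
    induction x with
    | zero => simp
    | add a b ha hb => simpa only [map_add] using congrArg₂ (· + ·) ha hb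
    | tmul a b => simp [P.swap_swap, Q.swap_swap]
  rel := Submodule.comap treeSplit
    (LinearMap.range (TensorProduct.map P.rel.subtype (LinearMap.id (M := TreeSpace k W))) ⊔
      LinearMap.range (TensorProduct.map (LinearMap.id (M := TreeSpace k V)) Q.rel.subtype))
  rel_stable σ x hx := by
    rw [Submodule.mem_comap] at hx ⊢
    rw [treeSplit_treePerm]
    obtain ⟨y, ⟨y, rfl⟩, z, ⟨z, rfl⟩, h⟩ := Submodule.mem_sup.1 hx
    rw [← h, map_add]
    refine Submodule.add_mem_sup ?_ ?_
    · refine ⟨TensorProduct.map ((treePerm P.swap σ).restrict (P.rel_stable σ))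
        (treePerm Q.swap σ) y, ?_⟩
      rw [← LinearMap.comp_apply, ← LinearMap.comp_apply, ← TensorProduct.map_comp,
        ← TensorProduct.map_comp]
      rfl
    · refine ⟨TensorProduct.map (treePerm P.swap σ)
        ((treePerm Q.swap σ).restrict (Q.rel_stable σ)) z, ?_⟩
      rw [← LinearMap.comp_apply, ← LinearMap.comp_apply, ← TensorProduct.map_comp,
        ← TensorProduct.map_comp]
      rfl

/-- The operad of Lie algebras: one antisymmetric generator and the Jacobi relation
`((1, 2), 3) + ((2, 3), 1) + ((3, 1), 2)`. -/
noncomputable def lie (k : Type u) [Field k] : BinaryQuadratic k k where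
  swap := -LinearMap.id
  swap_swap v := by simp
  rel := Submodule.span k {fun _ => 1 ⊗ₜ[k] 1}
  rel_stable σ r hr := by
    obtain ⟨a, rfl⟩ := Submodule.mem_span_singleton.1 hr
    rw [map_smul]
    refine Submodule.smul_mem _ _ (Submodule.mem_span_singleton.2
      ⟨if Equiv.Perm.sign σ = 1 then 1 else -1, ?_⟩)
    funext i
    simp only [treePerm, LinearMap.pi_apply, LinearMap.comp_apply, LinearMap.proj_apply]
    split_ifs <;> simp [TensorProduct.neg_tmul]

/-- The operad of commutative associative algebras: one symmetric generator and the relations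
that equate the trees `((1, 2), 3)`, `((2, 3), 1)` and `((3, 1), 2)`. -/
noncomputable def com (k : Type u) [Field k] : BinaryQuadratic k k where
  swap := LinearMap.id
  swap_swap v := rfl
  rel := Submodule.span k
    {r | ∃ i j : Fin 3, r = Pi.single i (1 ⊗ₜ[k] 1) - Pi.single j (1 ⊗ₜ[k] 1)}
  rel_stable σ r hr := by
    induction hr using Submodule.span_induction with
    | mem s hs =>
      obtain ⟨i, j, rfl⟩ := hs
      rw [map_sub, treePerm_single, treePerm_single]
      exact Submodule.subset_span ⟨σ i, σ j, by simp⟩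
    | zero => simp
    | add x y _ _ hx hy => rw [map_add]; exact add_mem hx hy
    | smul a x _ hx => rw [map_smul]; exact Submodule.smul_mem _ _ hx

end BinaryQuadratic

end QuadraticData

end QuadOperad

/-! All three operads are binary quadratic, so it suffices to match generators and arity-three
relations: an equivariant isomorphism of generators carrying one relation space onto the other
induces an isomorphism of the quotients (`operadIso`).

The generators of both Manin products are `(Ω →₀ k) ⊗ V`, identified with `Ω →₀ V` by
`replicaEquiv`. The symmetric group actions agree: for Lie, the sign of the bracket cancels the
twist by `sgn`; for Com there is no sign.

Black product: colouring the Jacobi relation gives, for each pair of colours `c`, the sum `colourSum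
k c` of the three coloured trees, each with coefficient one. Multiplying a relation `r` by this sum,
tree by tree, just colours `r` by `c` (`treeRename_treeProd_colourSum`), so the spanning sets of
relations correspond (`map_rel_black_lie`).

White product: modulo the relations of Com, coloured by `c`, the three trees become equal, and the
functional `colourCoeff c`, the sum of their coefficients, kills those relations. Applying
`colourCoeff c ⊗ id` after `Φ` extracts the `c`-coloured component (`colourCoeff_treeSplit`). Hence
every coloured component of a white relation lies in `R`. Conversely, write `t i` for the three
trees coloured by `c`; then `Φ` sends a coloured `r` to `∑ t i ⊗ r i = ∑ (t i - t 0) ⊗ r i + t 0 ⊗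
r`, with `r i` read as supported on the `i`-th tree, and this has the required form
(`treeProd_colourSum_mem_white`). Since `Ω` is finite, an element is the finite sum of its coloured
components, which gives equality (`map_rel_white_com`). -/

namespace QuadOperad

/-! ### Isomorphisms of operads and of their quotients -/

section Iso

variable {k : Type u} [Field k] {P : Operad.{u, v} k} {Q : Operad.{u, w} k}

/-- The inverse of an isomorphism of operads. -/
def Operad.Iso.symm (φ : P.Iso Q) : Q.Iso P where
  equiv n := (φ.equiv n).symm
  equiv_map e x := by
    rw [LinearEquiv.symm_apply_eq, φ.equiv_map, LinearEquiv.apply_symm_apply]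
  equiv_one := by rw [LinearEquiv.symm_apply_eq, φ.equiv_one]
  equiv_comp n μ ν := by
    rw [LinearEquiv.symm_apply_eq, φ.equiv_comp]
    simp only [LinearEquiv.apply_symm_apply]

/-- The preimage of an operadic ideal under an isomorphism of operads. -/
def Operad.Ideal.comap (φ : P.Iso Q) (J : Q.Ideal) : P.Ideal where
  carrier n := (J.carrier n).comap (φ.equiv n).toLinearMap
  map_mem e x hx := by
    simp only [Submodule.mem_comap, LinearEquiv.coe_coe] at hx ⊢
    rw [φ.equiv_map]
    exact J.map_mem e hx
  comp_mem_left n μ ν hμ := by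
    simp only [Submodule.mem_comap, LinearEquiv.coe_coe] at hμ ⊢
    rw [φ.equiv_comp]
    exact J.comp_mem_left n _ hμ
  comp_mem_right n μ ν i hν := by
    simp only [Submodule.mem_comap, LinearEquiv.coe_coe] at hν ⊢
    rw [φ.equiv_comp]
    exact J.comp_mem_right n _ _ i hν

theorem Operad.subset_idealSpan (R : Set (Σ n, P.obj n)) {r : Σ n, P.obj n} (hr : r ∈ R) :
    r.2 ∈ (P.idealSpan R).carrier r.1 := by
  simp only [Operad.idealSpan, Submodule.mem_iInf]
  exact fun I hI => hI r hr

theorem Operad.idealSpan_le {R : Set (Σ n, P.obj n)} {I : P.Ideal}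
    (h : ∀ r ∈ R, r.2 ∈ I.carrier r.1) (n : ℕ) :
    (P.idealSpan R).carrier n ≤ I.carrier n :=
  iInf₂_le I h

/-- The preimage under `φ` of the ideal generated by `S` is an ideal containing `R`, so minimality
of the ideal generated by `R` applies. -/
theorem Operad.Iso.map_mem_idealSpan (φ : P.Iso Q) {R : Set (Σ n, P.obj n)}
    {S : Set (Σ n, Q.obj n)} (h : ∀ r ∈ R, ⟨r.1, φ.equiv r.1 r.2⟩ ∈ S) {n : ℕ} {x : P.obj n}
    (hx : x ∈ (P.idealSpan R).carrier n) : φ.equiv n x ∈ (Q.idealSpan S).carrier n :=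
  Operad.idealSpan_le (I := (Q.idealSpan S).comap φ)
    (fun r hr => Operad.subset_idealSpan S (h r hr)) n hx

/-- An isomorphism of operads that matches two ideals induces an isomorphism of the
quotients. -/
noncomputable def Operad.Iso.quotient (φ : P.Iso Q) (I : P.Ideal) (J : Q.Ideal)
    (h : ∀ n, (I.carrier n).map (φ.equiv n).toLinearMap = J.carrier n) :
    I.quotient.Iso J.quotient where
  equiv n := Submodule.Quotient.equiv (I.carrier n) (J.carrier n) (φ.equiv n) (h n)
  equiv_map {n m} e x := by
    obtain ⟨x, rfl⟩ := Submodule.Quotient.mk_surjective _ x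
    exact congrArg Submodule.Quotient.mk (φ.equiv_map e x)
  equiv_one := congrArg Submodule.Quotient.mk φ.equiv_one
  equiv_comp {l} n μ ν := by
    obtain ⟨ν, rfl⟩ := I.exists_rep ν
    obtain ⟨μ, rfl⟩ := Submodule.Quotient.mk_surjective _ μ
    refine (congrArg (Submodule.Quotient.equiv _ _ (φ.equiv _) (h _))
      (I.quotCompHom_mk n μ ν)).trans ?_
    refine (congrArg Submodule.Quotient.mk (φ.equiv_comp n μ ν)).trans ?_
    exact (J.quotCompHom_mk n (φ.equiv l μ) (fun i => φ.equiv (n i) (ν i))).symm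

/-- An isomorphism of operads that matches two sets of relations induces an isomorphism of the
quotients by the ideals that they generate. -/
noncomputable def Operad.Iso.quotientSpan (φ : P.Iso Q) (R : Set (Σ n, P.obj n))
    (S : Set (Σ n, Q.obj n)) (hR : ∀ r ∈ R, ⟨r.1, φ.equiv r.1 r.2⟩ ∈ S)
    (hS : ∀ s ∈ S, ⟨s.1, φ.symm.equiv s.1 s.2⟩ ∈ R) :
    (P.idealSpan R).quotient.Iso (Q.idealSpan S).quotient :=
  φ.quotient _ _ fun n => by
    refine le_antisymm ?_ fun y hy => ?_
    · rintro _ ⟨x, hx, rfl⟩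
      exact φ.map_mem_idealSpan hR hx
    -- The reverse inclusion is the same lemma for the inverse isomorphism.
    · exact ⟨_, φ.symm.map_mem_idealSpan hS hy, (φ.equiv n).apply_symm_apply y⟩

/-- A tree is built from a composition, the unit placed at the leaf of the root, and a renaming of
leaves; `φ` preserves each of them. -/
theorem Operad.Iso.equiv_tree (φ : P.Iso Q) (i : Fin 3) (μ ν : P.obj 2) :
    φ.equiv 3 (P.tree i μ ν) = Q.tree i (φ.equiv 2 μ) (φ.equiv 2 ν) := by
  have h : (fun j => φ.equiv (treeArity j) (P.treeInputs μ j)) =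
      Q.treeInputs (φ.equiv 2 μ) := by
    funext j
    fin_cases j
    · rfl
    · exact φ.equiv_one
  change φ.equiv 3 (P.map (treeLeaves i) (P.comp treeArity ν (P.treeInputs μ))) =
    Q.map (treeLeaves i) (Q.comp treeArity (φ.equiv 2 ν) (Q.treeInputs (φ.equiv 2 μ)))
  rw [φ.equiv_map, φ.equiv_comp, h]

end Iso

/-! ### Functoriality of the free operad in its generators -/

section FreeFunctor

variable {k : Type u} {V : Type v} {W : Type w}

/-- Replacing the generators in a formal expression. -/
def Term.rename (f : V → W) : ∀ {n : ℕ}, Term k V n → Term k W n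
  | _, .gen v => .gen (f v)
  | _, .one => .one
  | _, .zero n => .zero n
  | _, .add x y => .add (x.rename f) (y.rename f)
  | _, .smul c x => .smul c (x.rename f)
  | _, .map e x => .map e (x.rename f)
  | _, .comp n μ ν => .comp n (μ.rename f) (fun i => (ν i).rename f)

/-- Needed for the rules of `Term.Rel` that express multilinearity, which are stated through
`Function.update`. -/
theorem Term.rename_update (f : V → W) {l : ℕ} {n : Fin l → ℕ} (ν : ∀ i, Term k V (n i))
    (i : Fin l) (x : Term k V (n i)) :
    (fun j => (Function.update ν i x j).rename f) =
      Function.update (fun j => (ν j).rename f) i (x.rename f) :=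
  funext fun j => Function.apply_update (fun _ y => Term.rename f y) ν i x j

theorem Term.rename_rename {f : V → W} {g : W → V} (h : ∀ v, g (f v) = v) {n : ℕ}
    (x : Term k V n) : (x.rename f).rename g = x := by
  induction x with
  | gen v => simp only [rename, h]
  | one => rfl
  | zero n => rfl
  | add x y hx hy => simp only [rename, hx, hy]
  | smul c x hx => simp only [rename, hx]
  | map e x hx => simp only [rename, hx]
  | comp n μ ν hμ hν => simp only [rename, hμ, hν]

variable [Field k] [AddCommGroup V] [Module k V] [AddCommGroup W] [Module k W]
  {τ : V →ₗ[k] V} {τ' : W →ₗ[k] W}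

/-- Each rule of the congruence is carried to the same rule. Linearity of `f` enters only in the
rules for sums and multiples of generators, and equivariance only in `gen_swap`. -/
theorem Term.Rel.rename {f : V →ₗ[k] W} (hf : ∀ v, f (τ v) = τ' (f v)) {n : ℕ}
    {x y : Term k V n} (h : Term.Rel τ x y) : Term.Rel τ' (x.rename f) (y.rename f) := by
  induction h with
  | refl x => exact .refl _
  | symm _ h => exact h.symm
  | trans _ _ h h' => exact h.trans h'
  | add_congr _ _ h h' => exact .add_congr h h'
  | smul_congr c _ h => exact .smul_congr c h
  | map_congr e _ h => exact .map_congr e h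
  | comp_congr n _ _ h h' => exact .comp_congr n h h'
  | add_comm x y => exact .add_comm _ _
  | add_assoc x y z => exact .add_assoc _ _ _
  | zero_add x => exact .zero_add _
  | zero_smul x => exact .zero_smul _
  | one_smul x => exact .one_smul _
  | mul_smul c d x => exact .mul_smul c d _
  | add_smul c d x => exact .add_smul c d _
  | smul_add c x y => exact .smul_add c _ _
  | map_add e x y => exact .map_add e _ _
  | map_smul e c x => exact .map_smul e c _
  | comp_add_left n μ μ' ν => exact .comp_add_left n _ _ _
  | comp_smul_left n c μ ν => exact .comp_smul_left n c _ _
  | comp_add_right n μ ν i x y =>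
    simp only [Term.rename, Term.rename_update]
    exact .comp_add_right n _ _ i _ _
  | comp_smul_right n μ ν i c x =>
    simp only [Term.rename, Term.rename_update]
    exact .comp_smul_right n _ _ i c _
  | map_refl x => exact .map_refl _
  | map_trans e f x => exact .map_trans e f _
  | comp_map_right σ μ ν => exact .comp_map_right σ _ _
  | comp_map_left σ n μ ν => exact .comp_map_left σ n _ (fun i => (ν i).rename f)
  | comp_assoc n m μ ν ξ =>
    exact .comp_assoc n m _ (fun i => (ν i).rename f) (fun i j => (ξ i j).rename f)
  | one_comp n ν => exact .one_comp n (fun i => (ν i).rename f)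
  | comp_one μ => exact .comp_one _
  | gen_add v w =>
    simp only [Term.rename, _root_.map_add]
    exact .gen_add _ _
  | gen_smul c v =>
    simp only [Term.rename, _root_.map_smul]
    exact .gen_smul _ _
  | gen_swap v =>
    simp only [Term.rename, hf]
    exact .gen_swap _

/-- An equivariant linear map of generators acts on the free operads. -/
def FreeObj.rename (f : V →ₗ[k] W) (hf : ∀ v, f (τ v) = τ' (f v)) (n : ℕ) :
    FreeObj τ n →ₗ[k] FreeObj τ' n where
  toFun := Quotient.map (Term.rename f) fun _ _ h => Term.Rel.rename hf h
  map_add' x y := by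
    obtain ⟨x, rfl⟩ := mk_surjective x
    obtain ⟨y, rfl⟩ := mk_surjective y
    rfl
  map_smul' c x := by
    obtain ⟨x, rfl⟩ := mk_surjective x
    rfl

/-- An equivariant isomorphism of generators induces an isomorphism of the free operads. -/
noncomputable def freeOperadIso (e : V ≃ₗ[k] W) (he : ∀ v, e (τ v) = τ' (e v)) :
    (freeOperad τ).Iso (freeOperad τ') where
  equiv n := LinearEquiv.ofLinearMap (FreeObj.rename e.toLinearMap he n)
    (FreeObj.rename e.symm.toLinearMap
      (fun w => by simp [LinearEquiv.symm_apply_eq, he]) n)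
    (LinearMap.ext fun x => by
      obtain ⟨x, rfl⟩ := FreeObj.mk_surjective x
      exact congrArg (FreeObj.mk τ') (Term.rename_rename e.apply_symm_apply x))
    (LinearMap.ext fun x => by
      obtain ⟨x, rfl⟩ := FreeObj.mk_surjective x
      exact congrArg (FreeObj.mk τ) (Term.rename_rename e.symm_apply_apply x))
  equiv_map f x := by
    obtain ⟨x, rfl⟩ := FreeObj.mk_surjective x
    rfl
  equiv_one := rfl
  equiv_comp {l} n μ ν := by
    obtain ⟨ν, rfl⟩ := FreeObj.exists_rep ν
    obtain ⟨μ, rfl⟩ := FreeObj.mk_surjective μ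
    refine (congrArg (FreeObj.rename e.toLinearMap he _) (FreeObj.compHom_mk n μ ν)).trans ?_
    exact (FreeObj.compHom_mk n (μ.rename e) (fun i => (ν i).rename e)).symm

theorem freeOperadIso_freeGen (e : V ≃ₗ[k] W) (he : ∀ v, e (τ v) = τ' (e v)) (v : V) :
    (freeOperadIso e he).equiv 2 (freeGen τ v) = freeGen τ' (e v) :=
  rfl

/-- The action of a linear map of generators on decorated trees. -/
noncomputable def treeRename (f : V →ₗ[k] W) : TreeSpace k V →ₗ[k] TreeSpace k W :=
  LinearMap.pi fun i => TensorProduct.map f f ∘ₗ LinearMap.proj i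

theorem treeRename_apply (f : V →ₗ[k] W) (r : TreeSpace k V) (i : Fin 3) :
    treeRename f r i = TensorProduct.map f f (r i) :=
  rfl

theorem treeRename_single (f : V →ₗ[k] W) (i : Fin 3) (a b : V) :
    treeRename (k := k) f (Pi.single i (a ⊗ₜ b)) = Pi.single i (f a ⊗ₜ f b) := by
  funext j
  by_cases hj : j = i
  · subst hj; simp [treeRename_apply]
  · simp [treeRename_apply, hj]

theorem treeMap_single (τ : V →ₗ[k] V) (i : Fin 3) (a b : V) :
    treeMap τ (Pi.single i (a ⊗ₜ b)) =
      (freeOperad τ).tree i (freeGen τ a) (freeGen τ b) := by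
  simp only [treeMap, LinearMap.sum_apply, LinearMap.comp_apply, LinearMap.proj_apply]
  rw [Finset.sum_eq_single i]
  · simp
  · intro j _ hj
    simp [hj]
  · simp

/-- Both sides are linear in `r`, so a single tree with pure tensor decorations suffices; there the
isomorphism commutes with `tree` and sends generators to generators. -/
theorem freeOperadIso_treeMap (e : V ≃ₗ[k] W) (he : ∀ v, e (τ v) = τ' (e v))
    (r : TreeSpace k V) :
    (freeOperadIso e he).equiv 3 (treeMap τ r) = treeMap τ' (treeRename e.toLinearMap r) := by
  have h : ((freeOperadIso e he).equiv 3).toLinearMap ∘ₗ treeMap τ =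
      treeMap τ' ∘ₗ treeRename e.toLinearMap := by
    refine LinearMap.pi_ext' fun i => ?_
    ext a b
    simp only [LinearMap.comp_apply, TensorProduct.AlgebraTensorModule.curry_apply,
      TensorProduct.curry_apply, LinearMap.coe_restrictScalars, LinearMap.coe_single,
      LinearEquiv.coe_coe]
    rw [treeRename_single, treeMap_single, treeMap_single, Operad.Iso.equiv_tree,
      freeOperadIso_freeGen, freeOperadIso_freeGen]
    rfl
  exact LinearMap.congr_fun h r

end FreeFunctor

/-! ### Isomorphisms of binary quadratic operads from their presentations -/

namespace BinaryQuadratic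

variable {k : Type u} [Field k] {V : Type v} [AddCommGroup V] [Module k V]
  {W : Type w} [AddCommGroup W] [Module k W]

/-- An equivariant isomorphism of generators that matches the relations induces an isomorphism
of binary quadratic operads. -/
noncomputable def operadIso {P : BinaryQuadratic k V} {Q : BinaryQuadratic k W} (e : V ≃ₗ[k] W)
    (he : ∀ v, e (P.swap v) = Q.swap (e v))
    (h : P.rel.map (treeRename e.toLinearMap) = Q.rel) : P.operad.Iso Q.operad :=
  (freeOperadIso e he).quotientSpan _ _
    (by
      rintro _ ⟨r, hr, rfl⟩
      exact ⟨treeRename e.toLinearMap r, h ▸ Submodule.mem_map_of_mem hr,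
        by rw [freeOperadIso_treeMap]⟩)
    (by
      rintro _ ⟨s, hs, rfl⟩
      -- By `h`, each relation of `Q` is the image of a relation `r` of `P`, so the inverse
      -- isomorphism returns the class of `r` itself.
      obtain ⟨r, hr, rfl⟩ := h ▸ hs
      refine ⟨r, hr, ?_⟩
      rw [← freeOperadIso_treeMap e he]
      exact congrArg (Sigma.mk 3) (LinearEquiv.symm_apply_apply _ _))

end BinaryQuadratic

/-! ### Replicas of the generators and coloured trees -/

section Replicas

variable {k : Type u} [Field k] {V : Type v} [AddCommGroup V] [Module k V] {Ω : Type w}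

variable (k V Ω) in
/-- The space `⨁ ω, M_ω` as a tensor product. -/
noncomputable def replicaEquiv : (Ω →₀ k) ⊗[k] V ≃ₗ[k] (Ω →₀ V) :=
  open Classical in TensorProduct.finsuppScalarLeft k V Ω

theorem replicaEquiv_single (ω : Ω) (a : k) (v : V) :
    replicaEquiv k V Ω (Finsupp.single ω a ⊗ₜ v) = Finsupp.single ω (a • v) := by
  classical
  ext i
  rw [replicaEquiv, TensorProduct.finsuppScalarLeft_apply_tmul_apply]
  by_cases h : ω = i
  · subst h; simp
  · simp [Finsupp.single_eq_of_ne' h]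

/-- This is the equivariance that `operadIso` requires, shared by the black and the white product.
-/
theorem replicaEquiv_swap (τ : V →ₗ[k] V) (x : (Ω →₀ k) ⊗[k] V) :
    replicaEquiv k V Ω (TensorProduct.map LinearMap.id τ x) =
      Finsupp.mapRange.linearMap τ (replicaEquiv k V Ω x) := by
  have h : (replicaEquiv k V Ω).toLinearMap ∘ₗ TensorProduct.map LinearMap.id τ =
      Finsupp.mapRange.linearMap τ ∘ₗ (replicaEquiv k V Ω).toLinearMap := by
    ext ω v : 4
    simp [replicaEquiv_single]
  exact LinearMap.congr_fun h x

theorem colour_single (c : Fin 2 → Ω) (i : Fin 3) (a b : V) :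
    BinaryQuadratic.colour (k := k) c (Pi.single i (a ⊗ₜ b)) =
      Pi.single i (Finsupp.single (c 1) a ⊗ₜ Finsupp.single (c 0) b) := by
  funext j
  by_cases hj : j = i
  · subst hj; simp [BinaryQuadratic.colour]
  · simp [BinaryQuadratic.colour, hj]

variable (k) in
/-- The sum of the three trees whose vertices are decorated by colours. -/
noncomputable def colourSum (c : Fin 2 → Ω) : TreeSpace k (Ω →₀ k) :=
  fun _ => Finsupp.single (c 1) 1 ⊗ₜ Finsupp.single (c 0) 1

/-- Tensoring a decoration with `Finsupp.single ω 1` places it in the replica `ω`. Since `colourSum`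
contains all three trees with coefficient one, no tree of `r` is lost or rescaled. Both halves of
the theorem rest on this identity. -/
theorem treeRename_treeProd_colourSum (c : Fin 2 → Ω) (r : TreeSpace k V) :
    treeRename (replicaEquiv k V Ω).toLinearMap
      (BinaryQuadratic.treeProd (colourSum k c) r) = BinaryQuadratic.colour c r := by
  funext i
  simp only [treeRename_apply, BinaryQuadratic.treeProd, BinaryQuadratic.colour, colourSum,
    LinearMap.mk₂_apply, LinearMap.pi_apply, LinearMap.comp_apply, LinearMap.proj_apply]
  generalize r i = y
  induction y with
  | zero => simp
  | add a b ha hb => simp only [TensorProduct.tmul_add, map_add, ha, hb]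
  | tmul a b => simp [replicaEquiv_single]

end Replicas

/-! ### The black product with the leveled matching operad of Lie -/

namespace BinaryQuadratic

variable {k : Type u} [Field k] {V : Type v} [AddCommGroup V] [Module k V] {Ω : Type w}

theorem colourSum_mem_lie (c : Fin 2 → Ω) :
    colourSum k c ∈ ((lie k).leveledMatching Ω).rel :=
  Submodule.subset_span ⟨fun _ => 1 ⊗ₜ 1, Submodule.mem_span_singleton_self _, c, rfl⟩

/-- The relations of Lie form the line through the Jacobi sum, so each pair of colours contributes
only the multiples of one element. -/
theorem rel_leveledMatching_lie :
    ((lie k).leveledMatching Ω).rel = Submodule.span k (Set.range (colourSum k)) := by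
  refine le_antisymm (Submodule.span_le.2 ?_) (Submodule.span_le.2 ?_)
  · rintro _ ⟨r, hr, c, rfl⟩
    obtain ⟨a, rfl⟩ := Submodule.mem_span_singleton.1 hr
    rw [map_smul]
    exact Submodule.smul_mem _ _ (Submodule.subset_span ⟨c, rfl⟩)
  · rintro _ ⟨c, rfl⟩
    exact colourSum_mem_lie c

/-- By bilinearity of `treeProd`, the black relations are spanned by the products of some `colourSum
k c` with some `r ∈ P.rel`, and these go exactly to the coloured relations `colour c r`. -/
theorem map_rel_black_lie (P : BinaryQuadratic k V) :
    (((lie k).leveledMatching Ω).black P).rel.map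
      (treeRename (replicaEquiv k V Ω).toLinearMap) = (P.leveledMatching Ω).rel := by
  refine le_antisymm ?_ (Submodule.span_le.2 ?_)
  · refine Submodule.map_le_iff_le_comap.2 (Submodule.span_le.2 ?_)
    rintro _ ⟨q, hq, r, hr, rfl⟩
    rw [rel_leveledMatching_lie] at hq
    rw [SetLike.mem_coe]
    -- With `r` fixed, the claim is linear in `q`, so `q` may be taken to be some `colourSum k c`.
    induction hq using Submodule.span_induction with
    | mem q hq =>
      obtain ⟨c, rfl⟩ := hq
      rw [Submodule.mem_comap, treeRename_treeProd_colourSum]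
      exact Submodule.subset_span ⟨r, hr, c, rfl⟩
    | zero => simp
    | add x y _ _ hx hy => rw [map_add]; exact add_mem hx hy
    | smul a x _ hx => rw [map_smul]; exact Submodule.smul_mem _ _ hx
  · rintro _ ⟨r, hr, c, rfl⟩
    exact ⟨treeProd (colourSum k c) r, Submodule.subset_span ⟨_, colourSum_mem_lie c, r, hr, rfl⟩,
      treeRename_treeProd_colourSum c r⟩

/-- `Lie^LMT ● 𝒫 ≅ 𝒫^LMT`. -/
noncomputable def blackLieIso (Ω : Type w) (P : BinaryQuadratic k V) :
    (((lie k).leveledMatching Ω).black P).operad.Iso (P.leveledMatching Ω).operad :=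
  operadIso (replicaEquiv k V Ω)
    (fun x => by
      rw [show (P.leveledMatching Ω).swap = Finsupp.mapRange.linearMap P.swap from rfl,
        ← replicaEquiv_swap]
      congr 1
      -- The sign from the antisymmetric bracket cancels the sign from the twist by `sgn`.
      have h : (((lie k).leveledMatching Ω).black P).swap =
          TensorProduct.map LinearMap.id P.swap := by
        ext ω v : 4
        simp [black, leveledMatching, lie, Finsupp.single_neg, TensorProduct.neg_tmul]
      rw [h])
    (map_rel_black_lie P)

/-! ### The white product with the leveled matching operad of Com -/

theorem swap_white_com (P : BinaryQuadratic k V) :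
    (((com k).leveledMatching Ω).white P).swap = TensorProduct.map LinearMap.id P.swap := by
  ext ω v : 4
  simp [white, leveledMatching, com]

/-- The sum of the coefficients of the three trees with vertices decorated by given colours. -/
noncomputable def colourCoeff (c : Fin 2 → Ω) : TreeSpace k (Ω →₀ k) →ₗ[k] k :=
  ∑ i, LinearMap.mul' k k ∘ₗ
    TensorProduct.map (Finsupp.lapply (c 1)) (Finsupp.lapply (c 0)) ∘ₗ LinearMap.proj i

theorem colourCoeff_single (c : Fin 2 → Ω) (i : Fin 3) (f g : Ω →₀ k) :
    colourCoeff c (Pi.single i (f ⊗ₜ g)) = f (c 1) * g (c 0) := by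
  simp only [colourCoeff, LinearMap.sum_apply, LinearMap.comp_apply, LinearMap.proj_apply]
  rw [Finset.sum_eq_single i]
  · simp
  · intro j _ hj
    simp [hj]
  · simp

/-- The relations are spanned by differences of two trees with the same vertex colours, and
`colourCoeff c` does not depend on the shape of the tree. -/
theorem colourCoeff_eq_zero (c : Fin 2 → Ω) {q : TreeSpace k (Ω →₀ k)}
    (hq : q ∈ ((com k).leveledMatching Ω).rel) : colourCoeff c q = 0 := by
  suffices h : ((com k).leveledMatching Ω).rel ≤ LinearMap.ker (colourCoeff c) from h hq
  refine Submodule.span_le.2 ?_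
  rintro _ ⟨r, hr, d, rfl⟩
  suffices h : (com k).rel ≤ (LinearMap.ker (colourCoeff c)).comap (colour d) from h hr
  refine Submodule.span_le.2 ?_
  rintro _ ⟨i, j, rfl⟩
  simp only [SetLike.mem_coe, Submodule.mem_comap, LinearMap.mem_ker, map_sub, colour_single,
    colourCoeff_single, sub_self]

/-- The part of a decorated tree in which the vertices have given colours. -/
noncomputable def uncolour (c : Fin 2 → Ω) : TreeSpace k (Ω →₀ V) →ₗ[k] TreeSpace k V :=
  LinearMap.pi fun i =>
    TensorProduct.map (Finsupp.lapply (c 1)) (Finsupp.lapply (c 0)) ∘ₗ LinearMap.proj i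

theorem uncolour_single (c : Fin 2 → Ω) (i : Fin 3) (f g : Ω →₀ V) :
    uncolour c (Pi.single i (f ⊗ₜ[k] g)) = Pi.single i (f (c 1) ⊗ₜ g (c 0)) := by
  funext j
  by_cases hj : j = i
  · subst hj; simp [uncolour]
  · simp [uncolour, hj]

/-- The tree space on `⨁ ω, M_ω` is the direct sum of its blocks indexed by pairs of colours, and
`colour c ∘ uncolour c` is the projection to the block of `c`. -/
theorem sum_colour_uncolour [Fintype Ω] [DecidableEq Ω] (x : TreeSpace k (Ω →₀ V)) :
    ∑ c : Fin 2 → Ω, colour c (uncolour c x) = x := by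
  have h : ∑ c : Fin 2 → Ω, colour c ∘ₗ uncolour c =
      LinearMap.id (R := k) (M := TreeSpace k (Ω →₀ V)) := by
    refine LinearMap.pi_ext' fun i => ?_
    ext ω a ω' b : 6
    simp only [LinearMap.comp_apply, TensorProduct.AlgebraTensorModule.curry_apply,
      TensorProduct.curry_apply, LinearMap.coe_restrictScalars, LinearMap.coe_single,
      LinearMap.sum_apply, LinearMap.id_apply, Finsupp.lsingle_apply]
    -- The order is reversed because the first tensor factor decorates the upper vertex, whose
    -- colour is `c 1`.
    rw [Finset.sum_eq_single ![ω', ω]]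
    · rw [uncolour_single, colour_single]
      simp
    · intro c _ hc
      rw [uncolour_single, colour_single]
      by_cases h1 : ω = c 1
      · have h0 : ω' ≠ c 0 := by
          rintro rfl
          refine hc (funext fun j => ?_)
          fin_cases j
          · rfl
          · exact h1.symm
        simp [Finsupp.single_eq_of_ne' h0]
      · simp [Finsupp.single_eq_of_ne' h1]
    · simp
  have := LinearMap.congr_fun h x
  simpa only [LinearMap.sum_apply, LinearMap.comp_apply, LinearMap.id_apply] using this

/-- The relations of the second factor are recovered from `Φ` by summing over the trees of the
first factor with given colours. -/
theorem colourCoeff_treeSplit (c : Fin 2 → Ω) (x : TreeSpace k ((Ω →₀ k) ⊗[k] V)) :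
    TensorProduct.lid k _ (TensorProduct.map (colourCoeff c) LinearMap.id (treeSplit x)) =
      uncolour c (treeRename (replicaEquiv k V Ω).toLinearMap x) := by
  have h : (TensorProduct.lid k (TreeSpace k V)).toLinearMap ∘ₗ
      TensorProduct.map (colourCoeff c) LinearMap.id ∘ₗ treeSplit =
      uncolour c ∘ₗ treeRename (replicaEquiv k V Ω).toLinearMap := by
    refine LinearMap.pi_ext' fun i => ?_
    ext ω a ω' b : 9
    simp only [LinearMap.comp_apply, TensorProduct.AlgebraTensorModule.curry_apply,
      TensorProduct.curry_apply, LinearMap.coe_restrictScalars, LinearMap.coe_single,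
      Finsupp.lsingle_apply, LinearEquiv.coe_coe]
    rw [treeSplit_single, treeRename_single, uncolour_single, TensorProduct.map_tmul,
      colourCoeff_single, LinearEquiv.coe_coe, replicaEquiv_single, replicaEquiv_single]
    -- Both sides vanish unless both colours agree with `c`; then both are the tree decorated by `a`
    -- and `b`.
    by_cases h1 : ω = c 1 <;> by_cases h0 : ω' = c 0 <;>
      simp [h1, h0]
  exact LinearMap.congr_fun h x

theorem treeSplit_treeProd_colourSum (c : Fin 2 → Ω) (r : TreeSpace k V) :
    treeSplit (treeProd (colourSum k c) r) =
      ∑ i, Pi.single i (Finsupp.single (c 1) 1 ⊗ₜ Finsupp.single (c 0) 1) ⊗ₜ[k]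
        Pi.single i (r i) := by
  simp only [treeSplit, LinearMap.sum_apply, LinearMap.comp_apply, LinearMap.proj_apply]
  refine Finset.sum_congr rfl fun i _ => ?_
  simp only [treeProd, colourSum, LinearMap.mk₂_apply]
  generalize r i = y
  induction y with
  | zero => simp
  | add a b ha hb => simp only [TensorProduct.tmul_add, map_add, ha, hb, Pi.single_add]
  | tmul a b => simp

/-- Modulo the relations of Com, the three coloured trees `t i` coincide, so `∑ t i ⊗ r i` is
congruent to `t 0 ⊗ r`, which lies in the second summand because `r` is a relation. -/
theorem treeProd_colourSum_mem_white {P : BinaryQuadratic k V} (c : Fin 2 → Ω)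
    {r : TreeSpace k V} (hr : r ∈ P.rel) :
    treeProd (colourSum k c) r ∈ (((com k).leveledMatching Ω).white P).rel := by
  let t (i : Fin 3) : TreeSpace k (Ω →₀ k) :=
    Pi.single i (Finsupp.single (c 1) 1 ⊗ₜ Finsupp.single (c 0) 1)
  have ht (i : Fin 3) : t i - t 0 ∈ ((com k).leveledMatching Ω).rel :=
    Submodule.subset_span ⟨_, Submodule.subset_span ⟨i, 0, rfl⟩, c, by rw [map_sub, colour_single, colour_single]⟩
  have h : treeSplit (treeProd (colourSum k c) r) =
      ∑ i, (t i - t 0) ⊗ₜ[k] (Pi.single i (r i) : TreeSpace k V) + t 0 ⊗ₜ[k] r := by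
    rw [treeSplit_treeProd_colourSum]
    -- Only the `r` in `t 0 ⊗ r` is expanded into its three components; the identity can then be
    -- checked tree by tree.
    nth_rewrite 3 [← Finset.univ_sum_single r]
    rw [TensorProduct.tmul_sum, ← Finset.sum_add_distrib]
    refine Finset.sum_congr rfl fun i _ => ?_
    rw [← TensorProduct.add_tmul]
    exact congrArg (· ⊗ₜ[k] _) (sub_add_cancel (t i) (t 0)).symm
  refine Submodule.mem_comap.2 ?_
  rw [h]
  refine Submodule.add_mem_sup (Submodule.sum_mem _ fun i _ => ?_) ?_
  · exact ⟨(⟨_, ht i⟩ : ((com k).leveledMatching Ω).rel) ⊗ₜ Pi.single i (r i), rfl⟩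
  · exact ⟨t 0 ⊗ₜ (⟨r, hr⟩ : P.rel), rfl⟩

/-- A white relation is the sum of its coloured components, each of which turns out to be a coloured
element of `P.rel`; conversely, coloured relations come from `treeProd_colourSum_mem_white`. -/
theorem map_rel_white_com [Finite Ω] (P : BinaryQuadratic k V) :
    (((com k).leveledMatching Ω).white P).rel.map
      (treeRename (replicaEquiv k V Ω).toLinearMap) = (P.leveledMatching Ω).rel := by
  classical
  have := Fintype.ofFinite Ω
  refine le_antisymm ?_ (Submodule.span_le.2 ?_)
  · rintro _ ⟨x, hx, rfl⟩
    rw [← sum_colour_uncolour (treeRename (replicaEquiv k V Ω).toLinearMap x)]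
    refine Submodule.sum_mem _ fun c _ => Submodule.subset_span ⟨_, ?_, c, rfl⟩
    -- The component of colour `c` is the image of `Φ(x)` under `colourCoeff c ⊗ id`. This map kills
    -- the summand with relations of Com in the first factor and sends the summand with relations of
    -- `P` in the second factor into `P.rel`.
    rw [← colourCoeff_treeSplit]
    obtain ⟨y, ⟨y, rfl⟩, z, ⟨z, rfl⟩, h⟩ := Submodule.mem_sup.1 hx
    rw [← h, map_add, map_add]
    clear h
    refine add_mem ?_ ?_
    · induction y with
      | zero => simp
      | add a b ha hb => simp only [map_add]; exact add_mem ha hb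
      | tmul a b =>
        simp only [TensorProduct.map_tmul, TensorProduct.lid_tmul, Submodule.subtype_apply]
        rw [colourCoeff_eq_zero c a.2, zero_smul]
        exact zero_mem _
    · induction z with
      | zero => simp
      | add a b ha hb => simp only [map_add]; exact add_mem ha hb
      | tmul a b =>
        simp only [TensorProduct.map_tmul, TensorProduct.lid_tmul, Submodule.subtype_apply]
        exact Submodule.smul_mem _ _ b.2
  · rintro _ ⟨r, hr, c, rfl⟩
    exact ⟨_, treeProd_colourSum_mem_white c hr, treeRename_treeProd_colourSum c r⟩

/-- `Com^LMT ○ 𝒫 ≅ 𝒫^LMT`. -/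
noncomputable def whiteComIso (Ω : Type w) [Finite Ω] (P : BinaryQuadratic k V) :
    (((com k).leveledMatching Ω).white P).operad.Iso (P.leveledMatching Ω).operad :=
  operadIso (replicaEquiv k V Ω)
    (fun x => by rw [swap_white_com, replicaEquiv_swap]; rfl)
    (map_rel_white_com P)

end BinaryQuadratic

end QuadOperad

theorem mainTheorem4 {k : Type u} [Field k] [CharZero k] {Ω : Type w} [Finite Ω] [Nonempty Ω]
    {V : Type v} [AddCommGroup V] [Module k V] [FiniteDimensional k V]
    (P : QuadOperad.BinaryQuadratic k V) :
    Nonempty (QuadOperad.Operad.Iso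
        (((QuadOperad.BinaryQuadratic.lie k).leveledMatching Ω).black P).operad
        (P.leveledMatching Ω).operad) ∧
      Nonempty (QuadOperad.Operad.Iso
        (P.leveledMatching Ω).operad
        (((QuadOperad.BinaryQuadratic.com k).leveledMatching Ω).white P).operad) :=
  ⟨⟨QuadOperad.BinaryQuadratic.blackLieIso Ω P⟩,
    ⟨(QuadOperad.BinaryQuadratic.whiteComIso Ω P).symm⟩⟩
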